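/- Let $n\ge 0$ be an integer and let $u\in\mathbb C$ be arbitrary. Let $\ddot{\mathfrak H}^{\mathfrak c}$ (the rational double affine Hecke–Clifford algebra) be the unital associative $\mathbb C$-algebra generated by $x_i,y_i,c_i$ $(1\le i\le n)$ and the symmetric group $S_n$ (with the multiplication of $S_n$), subject to the relations $$x_ix_j=x_jx_i,\quad y_iy_j=y_jy_i\quad(\text{all } i,j),$$ $$\sigma x_i=x_{\sigma i}\sigma,\quad \sigma y_i=y_{\sigma i}\sigma,\quad \sigma c_i=c_{\sigma i}\sigma\quad(\sigma\in S_n),$$ $$c_ix_i=-x_ic_i,\quad c_iy_i=y_ic_i,\quad c_jx_i=x_ic_j,\quad c_jy_i=y_ic_j\quad(i\ne j),$$ $$c_i^2=1,\quad c_ic_j=-c_jc_i\quad(i\neq j),$$ $$[y_j,x_i]=u(1+c_jc_i)s_{ij}\quad(i\ne j),\qquad [y_i,x_i]=-u\sum_{k\ne i}(1+c_kc_i)s_{ki},$$ where $s_{ij}\in S_n$ is the transposition of $i$ and $j$ and $[a,b]=ab-ba$. Let $\mathcal C_n$ be the Clifford algebra generated by $c_1,\dots,c_n$ with relations $c_i^2=1$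 and $c_ic_j=-c_jc_i$ for $i\ne j$. Sending generators to the elements of the same name defines algebra homomorphisms from $\mathbb C[x_1,\dots,x_n]$, $\mathbb C S_n$, $\mathcal C_n$ and $\mathbb C[y_1,\dots,y_n]$ to $\ddot{\mathfrak H}^{\mathfrak c}$. **Theorem (PBW property).** Multiplying the images under these homomorphisms, $p\otimes g\otimes a\otimes q\mapsto p\,g\,a\,q$, gives an isomorphism of complex vector spaces $$\mathbb C[x_1,\ldots,x_n]\otimes\mathbb C S_n\otimes\mathcal C_n\otimes\mathbb C[y_1,\ldots,y_n]\ \xrightarrow{\ \cong\ }\ \ddot{\mathfrak H}^{\mathfrak c}.$$ -/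

import Mathlib

open scoped TensorProduct

noncomputable section

namespace DoubleAffineHeckeClifford

/-- The generators: `x i`, `y i`, `c i` for `1 ≤ i ≤ n`, and one generator for each element of the
symmetric group `S_n`. -/
inductive Gen (n : ℕ) : Type
  | x (i : Fin n) : Gen n
  | y (i : Fin n) : Gen n
  | c (i : Fin n) : Gen n
  | s (σ : Equiv.Perm (Fin n)) : Gen n

namespace Free

/-- The generator `x_i` in the free algebra. -/
abbrev x {n : ℕ} (i : Fin n) : FreeAlgebra ℂ (Gen n) := FreeAlgebra.ι ℂ (Gen.x i)

/-- The generator `y_i` in the free algebra. -/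
abbrev y {n : ℕ} (i : Fin n) : FreeAlgebra ℂ (Gen n) := FreeAlgebra.ι ℂ (Gen.y i)

/-- The generator `c_i` in the free algebra. -/
abbrev c {n : ℕ} (i : Fin n) : FreeAlgebra ℂ (Gen n) := FreeAlgebra.ι ℂ (Gen.c i)

/-- The generator attached to `σ ∈ S_n` in the free algebra. -/
abbrev s {n : ℕ} (σ : Equiv.Perm (Fin n)) : FreeAlgebra ℂ (Gen n) := FreeAlgebra.ι ℂ (Gen.s σ)

end Free

open Free in
/-- The defining relations of the rational double affine Hecke-Clifford algebra. The first two say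
that the generators attached to `S_n` multiply as in `S_n`. -/
inductive Rel (n : ℕ) (u : ℂ) : FreeAlgebra ℂ (Gen n) → FreeAlgebra ℂ (Gen n) → Prop
  | s_one : Rel n u (s 1) 1
  | s_mul (σ τ : Equiv.Perm (Fin n)) : Rel n u (s (σ * τ)) (s σ * s τ)
  | x_comm (i j : Fin n) : Rel n u (x i * x j) (x j * x i)
  | y_comm (i j : Fin n) : Rel n u (y i * y j) (y j * y i)
  | s_x (σ : Equiv.Perm (Fin n)) (i : Fin n) : Rel n u (s σ * x i) (x (σ i) * s σ)
  | s_y (σ : Equiv.Perm (Fin n)) (i : Fin n) : Rel n u (s σ * y i) (y (σ i) * s σ)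
  | c_x_self (i : Fin n) : Rel n u (c i * x i) (-(x i * c i))
  | c_y_self (i : Fin n) : Rel n u (c i * y i) (y i * c i)
  | c_x (i j : Fin n) (h : i ≠ j) : Rel n u (c j * x i) (x i * c j)
  | c_y (i j : Fin n) (h : i ≠ j) : Rel n u (c j * y i) (y i * c j)
  | s_c (σ : Equiv.Perm (Fin n)) (i : Fin n) : Rel n u (s σ * c i) (c (σ i) * s σ)
  | c_sq (i : Fin n) : Rel n u (c i ^ 2) 1
  | c_c (i j : Fin n) (h : i ≠ j) : Rel n u (c i * c j) (-(c j * c i))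
  | y_x (i j : Fin n) (h : i ≠ j) :
      Rel n u (y j * x i - x i * y j) (u • ((1 + c j * c i) * s (Equiv.swap i j)))
  | y_x_self (i : Fin n) :
      Rel n u (y i * x i - x i * y i)
        (-(u • ∑ k ∈ Finset.univ.erase i, (1 + c k * c i) * s (Equiv.swap k i)))

end DoubleAffineHeckeClifford

open DoubleAffineHeckeClifford

/-- The rational double affine Hecke-Clifford algebra (DaHCa) with parameter `u`. -/
def DAHCa (n : ℕ) (u : ℂ) : Type := RingQuot (Rel n u)

namespace DAHCa

instance (n : ℕ) (u : ℂ) : Ring (DAHCa n u) := inferInstanceAs (Ring (RingQuot (Rel n u)))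

instance (n : ℕ) (u : ℂ) : Algebra ℂ (DAHCa n u) :=
  inferInstanceAs (Algebra ℂ (RingQuot (Rel n u)))

/-- The quotient map from the free algebra. -/
def mk (n : ℕ) (u : ℂ) : FreeAlgebra ℂ (Gen n) →ₐ[ℂ] DAHCa n u := RingQuot.mkAlgHom ℂ (Rel n u)

theorem mk_rel {n : ℕ} {u : ℂ} {a b : FreeAlgebra ℂ (Gen n)} (h : Rel n u a b) :
    mk n u a = mk n u b := RingQuot.mkAlgHom_rel ℂ h

/-- The element `x_i` of the DaHCa. -/
def x {n : ℕ} (u : ℂ) (i : Fin n) : DAHCa n u := mk n u (Free.x i)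

/-- The element `y_i` of the DaHCa. -/
def y {n : ℕ} (u : ℂ) (i : Fin n) : DAHCa n u := mk n u (Free.y i)

/-- The element `c_i` of the DaHCa. -/
def c {n : ℕ} (u : ℂ) (i : Fin n) : DAHCa n u := mk n u (Free.c i)

/-- The element of the DaHCa given by `σ ∈ S_n`. -/
def s {n : ℕ} (u : ℂ) (σ : Equiv.Perm (Fin n)) : DAHCa n u := mk n u (Free.s σ)

theorem x_comm {n : ℕ} (u : ℂ) (i j : Fin n) : x u i * x u j = x u j * x u i := by
  simpa [x] using mk_rel (u := u) (Rel.x_comm i j)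

theorem y_comm {n : ℕ} (u : ℂ) (i j : Fin n) : y u i * y u j = y u j * y u i := by
  simpa [y] using mk_rel (u := u) (Rel.y_comm i j)

theorem c_mul_self {n : ℕ} (u : ℂ) (i : Fin n) : c u i * c u i = 1 := by
  simpa [c, pow_two] using mk_rel (u := u) (Rel.c_sq i)

theorem c_anticomm {n : ℕ} (u : ℂ) (i j : Fin n) (h : i ≠ j) :
    c u i * c u j = -(c u j * c u i) := by
  simpa [c] using mk_rel (u := u) (Rel.c_c i j h)

end DAHCa

namespace DoubleAffineHeckeClifford

/-- For pairwise commuting elements `f i` of an algebra, the algebra homomorphism from the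
polynomial algebra that sends `X i` to `f i`. (`MvPolynomial.aeval` needs a commutative target, here
the subalgebra generated by the `f i`.) -/
def polyHom {ι A : Type} [Ring A] [Algebra ℂ A] (f : ι → A) (hf : ∀ i j, f i * f j = f j * f i) :
    MvPolynomial ι ℂ →ₐ[ℂ] A :=
  letI : CommRing (Algebra.adjoin ℂ (Set.range f)) :=
    { (inferInstance : Ring (Algebra.adjoin ℂ (Set.range f))) with
      mul_comm := (Algebra.isMulCommutative_adjoin ℂ (s := Set.range f)
        (by rintro _ ⟨i, rfl⟩ _ ⟨j, rfl⟩; exact hf i j)).is_comm.comm }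
  (Algebra.adjoin ℂ (Set.range f)).val.comp
    (MvPolynomial.aeval fun i => ⟨f i, Algebra.subset_adjoin ⟨i, rfl⟩⟩)

theorem polyHom_X {ι A : Type} [Ring A] [Algebra ℂ A] (f : ι → A)
    (hf : ∀ i j, f i * f j = f j * f i) (i : ι) : polyHom f hf (MvPolynomial.X i) = f i := by
  simp [polyHom]

/-- The quadratic form `v ↦ ∑ i, v i ^ 2` on `ℂ ^ n`. -/
def cliffordForm (n : ℕ) : QuadraticForm ℂ (Fin n → ℂ) :=
  QuadraticMap.weightedSumSquares ℂ (fun _ : Fin n => (1 : ℂ))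

/-- The Clifford algebra `C_n`, generated by `c_1, …, c_n` with `c_i ^ 2 = 1` and
`c_i c_j = -c_j c_i` for `i ≠ j`. -/
abbrev Cliff (n : ℕ) : Type := CliffordAlgebra (cliffordForm n)

/-- The generator `c_i` of the Clifford algebra `C_n`. -/
def Cliff.c {n : ℕ} (i : Fin n) : Cliff n :=
  CliffordAlgebra.ι (cliffordForm n) (Pi.single i 1)

end DoubleAffineHeckeClifford

namespace DAHCa

/-- The inclusion `ℂ[x_1, …, x_n] → DAHCa n u`, `X i ↦ x_i`. -/
def polyX (n : ℕ) (u : ℂ) : MvPolynomial (Fin n) ℂ →ₐ[ℂ] DAHCa n u := polyHom (x u) (x_comm u)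

/-- The inclusion `ℂ[y_1, …, y_n] → DAHCa n u`, `X i ↦ y_i`. -/
def polyY (n : ℕ) (u : ℂ) : MvPolynomial (Fin n) ℂ →ₐ[ℂ] DAHCa n u := polyHom (y u) (y_comm u)

/-- The multiplicative map `S_n → DAHCa n u`. -/
def sHom (n : ℕ) (u : ℂ) : Equiv.Perm (Fin n) →* DAHCa n u where
  toFun := s u
  map_one' := by simpa [s] using mk_rel (u := u) (Rel.s_one (n := n))
  map_mul' σ τ := by simpa [s] using mk_rel (u := u) (Rel.s_mul σ τ)

/-- The inclusion `ℂ S_n → DAHCa n u` of the group algebra of the symmetric group. -/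
def groupAlg (n : ℕ) (u : ℂ) : MonoidAlgebra ℂ (Equiv.Perm (Fin n)) →ₐ[ℂ] DAHCa n u :=
  MonoidAlgebra.lift ℂ (DAHCa n u) (Equiv.Perm (Fin n)) (sHom n u)

/-- The linear map `ℂ ^ n → DAHCa n u`, `v ↦ ∑ i, v i • c_i`. -/
def cLin (n : ℕ) (u : ℂ) : (Fin n → ℂ) →ₗ[ℂ] DAHCa n u := Fintype.linearCombination ℂ (c u)

theorem cLin_sq (n : ℕ) (u : ℂ) (v : Fin n → ℂ) :
    cLin n u v * cLin n u v = algebraMap ℂ (DAHCa n u) (cliffordForm n v) := by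
  have h1 : cLin n u v * cLin n u v
      = ∑ i, ∑ j, (v i * v j) • (c u i * c u j) := by
    simp only [cLin, Fintype.linearCombination_apply, Finset.sum_mul_sum, smul_mul_smul_comm]
  have h2 : cLin n u v * cLin n u v
      = ∑ i, ∑ j, (v i * v j) • (c u j * c u i) := by
    rw [h1, Finset.sum_comm]
    exact Finset.sum_congr rfl fun i _ => Finset.sum_congr rfl fun j _ => by rw [mul_comm (v j)]
  have h3 : (2 : ℂ) • (cLin n u v * cLin n u v)
      = (2 : ℂ) • algebraMap ℂ (DAHCa n u) (cliffordForm n v) := by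
    rw [two_smul]
    nth_rewrite 1 [h1]
    rw [h2, ← Finset.sum_add_distrib]
    simp only [← Finset.sum_add_distrib, ← smul_add]
    have h4 : ∀ i j : Fin n, (v i * v j) • (c u i * c u j + c u j * c u i)
        = if j = i then (2 : ℂ) • algebraMap ℂ (DAHCa n u) (v i * v i) else 0 := by
      intro i j
      split_ifs with h
      · subst h
        rw [c_mul_self, ← two_smul ℂ (1 : DAHCa n u), smul_comm, Algebra.algebraMap_eq_smul_one]
      · rw [c_anticomm u i j (Ne.symm h), neg_add_cancel, smul_zero]
    simp only [h4, Finset.sum_ite_eq', Finset.mem_univ, if_true,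
      ← Finset.smul_sum, ← map_sum]
    simp [cliffordForm, QuadraticMap.weightedSumSquares_apply]
  exact smul_right_injective _ (two_ne_zero' ℂ) h3

/-- The inclusion `C_n → DAHCa n u` of the Clifford algebra. -/
def cliff (n : ℕ) (u : ℂ) : Cliff n →ₐ[ℂ] DAHCa n u :=
  CliffordAlgebra.lift (cliffordForm n) ⟨cLin n u, cLin_sq n u⟩

theorem polyX_X {n : ℕ} (u : ℂ) (i : Fin n) : polyX n u (MvPolynomial.X i) = x u i :=
  polyHom_X _ _ i

theorem polyY_X {n : ℕ} (u : ℂ) (i : Fin n) : polyY n u (MvPolynomial.X i) = y u i :=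
  polyHom_X _ _ i

theorem groupAlg_of {n : ℕ} (u : ℂ) (σ : Equiv.Perm (Fin n)) :
    groupAlg n u (MonoidAlgebra.of ℂ _ σ) = s u σ := by
  simp [groupAlg, sHom]

theorem cliff_c {n : ℕ} (u : ℂ) (i : Fin n) : cliff n u (Cliff.c i) = c u i := by
  simp [cliff, Cliff.c, cLin]

end DAHCa

end

open DoubleAffineHeckeClifford

/-!
# The PBW theorem for the rational double affine Hecke-Clifford algebra

The algebra is made to act on `V = ℂ[x] ⊗ ℂ S_n ⊗ C_n ⊗ ℂ[y]` in such a way that multiplication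
`m : V → DAHCa n u` becomes a homomorphism of modules and `m v` sends `1 ⊗ 1 ⊗ 1 ⊗ 1` to `v`. Then
`h ↦ h (1 ⊗ 1 ⊗ 1 ⊗ 1)` is a two-sided inverse of `m` (`mulEquiv`).

Write `V = ℂ[x] ⊗ U`, where `U = ℂ S_n ⊗ C_n ⊗ ℂ[y]` is the regular module of the algebra generated
by `S_n`, the `c_i` and the `y_i`, which have no commutators depending on `u` among themselves. The
`x_j` act on `V` by multiplication, and a linear map out of `V` is determined by its restriction to
`1 ⊗ U` and by how it passes the `x_j` (`xOp_ext`). Conversely, given commuting operators `M j` on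
a space `N` and a linear map `U → N`, some linear map `V → N` extends it and turns the `x_j` into
the `M j` (`extend`). This defines `s_σ` and `c_k` on `V`.

The operator `y_i` must satisfy `y_i x_j = x_j y_i + κ_ij`, where the prescribed commutator `κ_ij`
(`kappa`) involves only `S_n` and the `c_k`. Such an operator is the first component of a map
`V → V × V`, `v ↦ (y_i v, v)`, that turns `x_j` into `(v, w) ↦ (x_j v + κ_ij w, x_j w)`
(`pairOp`). These operators commute with each other exactly because of the Jacobi identity
`[κ_ij, x_k] = [κ_ik, x_j]` (`XRel.kappa_commutator_x`), so that `extend` applies. All remaining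
relations on `V`, among them `y_i y_j = y_j y_i`, and the compatibility of `m` with the action
follow from `xOp_ext`: both sides agree on `1 ⊗ U`, and they pass the `x_j` in the same way, for the
`y_i` because of the second Jacobi identity `[κ_ik, y_j] = [κ_jk, y_i]` (`kappa_commutator_y`).
-/

namespace DoubleAffineHeckeClifford

/-! ### The commutators `[y_i, x_j]` in a Hecke-Clifford algebra -/

/-- The sign by which `c_k` commutes past `x_j`: it is `-1` if `k = j` and `1` otherwise. -/
def sgn {n : ℕ} (k j : Fin n) : ℤ := if k = j then -1 else 1

/-- A map `s` on `S_n` and a family `c` in a ring that satisfy the defining relations of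
`ℂ S_n ⋉ C_n`. -/
structure CliffordSymRel {n : ℕ} {R : Type} [Ring R] (s : Equiv.Perm (Fin n) → R)
    (c : Fin n → R) : Prop where
  s_one : s 1 = 1
  s_mul : ∀ σ τ, s (σ * τ) = s σ * s τ
  c_sq : ∀ i, c i * c i = 1
  c_c : ∀ i j, i ≠ j → c i * c j = -(c j * c i)
  s_c : ∀ σ i, s σ * c i = c (σ i) * s σ

/-- In addition to the relations of `ℂ S_n ⋉ C_n`, those for elements `x i` that commute, are
permuted by `S_n` and commute or anticommute with the `c k`. -/
structure XRel {n : ℕ} {R : Type} [Ring R] (s : Equiv.Perm (Fin n) → R)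
    (c x : Fin n → R) : Prop extends CliffordSymRel s c where
  x_comm : ∀ i j, x i * x j = x j * x i
  s_x : ∀ σ i, s σ * x i = x (σ i) * s σ
  c_x : ∀ k j, c k * x j = sgn k j • (x j * c k)

/-- The relations for elements `y i` that commute, are permuted by `S_n` and commute with the
`c k`. -/
structure YRel {n : ℕ} {R : Type} [Ring R] (s : Equiv.Perm (Fin n) → R)
    (c y : Fin n → R) : Prop where
  y_comm : ∀ i j, y i * y j = y j * y i
  s_y : ∀ σ i, s σ * y i = y (σ i) * s σ
  c_y : ∀ k i, c k * y i = y i * c k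

section Exchange

variable {n : ℕ} {R : Type} [Ring R]

/-- The element `(1 + c_a c_b) s_{ab}`, from which all the commutators `[y_i, x_j]` are built. -/
def exch (s : Equiv.Perm (Fin n) → R) (c : Fin n → R) (a b : Fin n) : R :=
  (1 + c a * c b) * s (Equiv.swap a b)

/-- The prescribed value of the commutator `[y_i, x_j]`. -/
def kappa [Algebra ℂ R] (u : ℂ) (s : Equiv.Perm (Fin n) → R) (c : Fin n → R) (i j : Fin n) : R :=
  if i = j then -(u • ∑ k ∈ Finset.univ.erase j, exch s c k j) else u • exch s c i j

variable {s : Equiv.Perm (Fin n) → R} {c x y : Fin n → R}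

/-- If only the summand `exch s c k j` fails to commute with `z`, the commutator of `z` with
`kappa u s c j j` comes from that summand. -/
theorem kappa_self_commutator [Algebra ℂ R] (u : ℂ) (j k : Fin n) (hkj : k ≠ j) (z : R)
    (hz : ∀ l, l ≠ j → l ≠ k → exch s c l j * z = z * exch s c l j) :
    kappa u s c j j * z - z * kappa u s c j j =
      -(u • (exch s c k j * z - z * exch s c k j)) := by
  have h1 : ∀ l ∈ Finset.univ.erase j, l ≠ k → exch s c l j * z - z * exch s c l j = 0 :=
    fun l hl hlk => sub_eq_zero.2 (hz l (Finset.ne_of_mem_erase hl) hlk)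
  rw [kappa, if_pos rfl, neg_mul, mul_neg, smul_mul_assoc, mul_smul_comm, Finset.sum_mul,
    Finset.mul_sum, ← Finset.sum_eq_single_of_mem k (by simpa using hkj) h1,
    Finset.sum_sub_distrib, smul_sub]
  abel

namespace XRel

variable (h : XRel s c x)
include h

theorem s_mul_exch (σ : Equiv.Perm (Fin n)) (a b : Fin n) :
    s σ * exch s c a b = exch s c (σ a) (σ b) * s σ := by
  have hs : σ * Equiv.swap a b = Equiv.swap (σ a) (σ b) * σ := Equiv.mul_swap_eq_swap_mul σ a b
  have h1 : s σ * s (Equiv.swap a b) = s (Equiv.swap (σ a) (σ b)) * s σ := by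
    rw [← h.s_mul, hs, h.s_mul]
  unfold exch
  have h2 : s σ * (1 + c a * c b) = (1 + c (σ a) * c (σ b)) * s σ := by
    rw [mul_add, add_mul, mul_one, one_mul, ← mul_assoc, h.s_c, mul_assoc, h.s_c, ← mul_assoc]
  rw [mul_assoc, ← h1, ← mul_assoc, h2, mul_assoc]

theorem c_mul_exch (k a b : Fin n) (hab : a ≠ b) :
    c k * exch s c a b = sgn k b • (exch s c a b * c k) := by
  unfold exch
  rw [mul_assoc, h.s_c, ← mul_assoc, ← mul_assoc]
  by_cases hb : k = b
  · subst hb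
    rw [Equiv.swap_apply_right, sgn, if_pos rfl, neg_one_smul, ← neg_mul]
    congr 1
    rw [mul_add, add_mul, one_mul, mul_one, ← mul_assoc, h.c_c k a hab.symm,
      neg_mul, mul_assoc, h.c_sq, mul_assoc, h.c_c k a hab.symm, mul_neg, ← mul_assoc, h.c_sq]
    noncomm_ring
  rw [sgn, if_neg hb, one_smul]
  by_cases ha : k = a
  · subst ha
    rw [Equiv.swap_apply_left]
    congr 1
    rw [mul_add, add_mul, one_mul, mul_one, ← mul_assoc, h.c_sq, mul_assoc, h.c_sq]
    noncomm_ring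
  · rw [Equiv.swap_apply_of_ne_of_ne ha hb]
    congr 1
    rw [mul_add, add_mul, one_mul, mul_one, ← mul_assoc, h.c_c k a ha, neg_mul, mul_assoc,
      h.c_c k b hb, mul_neg, neg_neg, mul_assoc]

theorem exch_mul_x_of_ne (a b k : Fin n) (ha : k ≠ a) (hb : k ≠ b) :
    exch s c a b * x k = x k * exch s c a b := by
  have hax := h.c_x a k
  have hbx := h.c_x b k
  rw [sgn, if_neg ha.symm, one_smul] at hax
  rw [sgn, if_neg hb.symm, one_smul] at hbx
  unfold exch
  rw [mul_assoc, h.s_x, Equiv.swap_apply_of_ne_of_ne ha hb, ← mul_assoc, ← mul_assoc]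
  congr 1
  rw [mul_add, add_mul, one_mul, mul_one, mul_assoc, hbx, ← mul_assoc, hax, mul_assoc]

/-- The Jacobi identity for `y_a`, `x_a`, `x_b`. -/
theorem exch_commutator_x (a b : Fin n) (hab : a ≠ b) :
    exch s c a b * x a - x a * exch s c a b = -(exch s c b a * x b - x b * exch s c b a) := by
  have h1 := h.c_x a b
  have h2 := h.c_x b a
  have h3 := h.c_x a a
  have h4 := h.c_x b b
  rw [sgn, if_neg hab, one_smul] at h1
  rw [sgn, if_neg hab.symm, one_smul] at h2
  rw [sgn, if_pos rfl, neg_one_smul] at h3 h4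
  unfold exch
  rw [Equiv.swap_comm b a, mul_assoc, h.s_x, Equiv.swap_apply_left, mul_assoc _ _ (x b), h.s_x,
    Equiv.swap_apply_right]
  simp only [← mul_assoc, ← sub_mul, ← neg_mul]
  congr 1
  rw [h.c_c b a hab.symm]
  simp only [mul_add, add_mul, one_mul, mul_one, mul_neg, neg_mul, mul_assoc, h2, h4]
  simp only [← mul_assoc, h1, h3]
  noncomm_ring

variable [Algebra ℂ R]

theorem s_mul_kappa (u : ℂ) (σ : Equiv.Perm (Fin n)) (i j : Fin n) :
    s σ * kappa u s c i j = kappa u s c (σ i) (σ j) * s σ := by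
  unfold kappa
  by_cases hij : i = j
  · subst hij
    simp only [if_true, mul_neg, neg_mul, mul_smul_comm, smul_mul_assoc, Finset.mul_sum,
      Finset.sum_mul, h.s_mul_exch]
    congr 2
    refine Finset.sum_equiv σ (fun k => ?_) (fun _ _ => rfl)
    simp
  · rw [if_neg hij, if_neg (σ.injective.ne hij), mul_smul_comm, h.s_mul_exch, smul_mul_assoc]

theorem c_mul_kappa (u : ℂ) (k i j : Fin n) :
    c k * kappa u s c i j = sgn k j • (kappa u s c i j * c k) := by
  unfold kappa
  by_cases hij : i = j
  · subst hij
    rw [if_pos rfl, mul_neg, neg_mul, mul_smul_comm, smul_mul_assoc, Finset.mul_sum,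
      Finset.sum_mul, smul_neg, smul_comm (sgn k i)]
    congr 2
    rw [Finset.smul_sum]
    exact Finset.sum_congr rfl fun l hl => h.c_mul_exch k l i (Finset.ne_of_mem_erase hl)
  · rw [if_neg hij, mul_smul_comm, h.c_mul_exch k i j hij, smul_mul_assoc, smul_comm]

theorem kappa_commutator_x_aux (u : ℂ) (j k : Fin n) (hjk : j ≠ k) :
    kappa u s c j j * x k - x k * kappa u s c j j =
      kappa u s c j k * x j - x j * kappa u s c j k := by
  rw [kappa_self_commutator u j k hjk.symm (x k)
    (fun l hl hlk => h.exch_mul_x_of_ne l j k hlk.symm hjk.symm), kappa, if_neg hjk,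
    smul_mul_assoc, mul_smul_comm, ← smul_sub, h.exch_commutator_x j k hjk, smul_neg]

/-- The Jacobi identity for `y_i`, `x_j`, `x_k`. -/
theorem kappa_commutator_x (u : ℂ) (i j k : Fin n) :
    kappa u s c i j * x k - x k * kappa u s c i j =
      kappa u s c i k * x j - x j * kappa u s c i k := by
  by_cases hjk : j = k
  · rw [hjk]
  by_cases hij : i = j
  · subst hij
    exact h.kappa_commutator_x_aux u i k hjk
  by_cases hik : i = k
  · subst hik
    exact (h.kappa_commutator_x_aux u i j hij).symm
  rw [kappa, if_neg hij, kappa, if_neg hik, smul_mul_assoc, mul_smul_comm, smul_mul_assoc,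
    mul_smul_comm, h.exch_mul_x_of_ne i j k (Ne.symm hik) (Ne.symm hjk),
    h.exch_mul_x_of_ne i k j (Ne.symm hij) hjk, sub_self, sub_self]

end XRel

section

variable (s_y : ∀ σ i, s σ * y i = y (σ i) * s σ) (c_y : ∀ k i, c k * y i = y i * c k)
include s_y c_y

/-- Since the `c_k` commute with the `y_i`, only the transposition acts. In particular `y_a + y_b`
commutes with `exch s c a b`. -/
theorem exch_mul_y (a b k : Fin n) :
    exch s c a b * y k = (y (Equiv.swap a b k)) * exch s c a b := by
  unfold exch
  rw [mul_assoc, s_y, ← mul_assoc, ← mul_assoc]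
  congr 1
  rw [mul_add, add_mul, one_mul, mul_one, mul_assoc, c_y, ← mul_assoc, c_y, mul_assoc]

variable [Algebra ℂ R]

theorem kappa_commutator_y_aux (u : ℂ) (i j : Fin n) (hij : i ≠ j) :
    kappa u s c i i * y j - y j * kappa u s c i i =
      kappa u s c j i * y i - y i * kappa u s c j i := by
  rw [kappa_self_commutator u i j hij.symm (y j) (fun l hl hlj => by
      rw [exch_mul_y s_y c_y, Equiv.swap_apply_of_ne_of_ne hlj.symm hij.symm]),
    kappa, if_neg hij.symm, smul_mul_assoc, mul_smul_comm, ← smul_sub, exch_mul_y s_y c_y,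
    exch_mul_y s_y c_y, Equiv.swap_apply_left, Equiv.swap_apply_right, ← smul_neg, neg_sub]

/-- The Jacobi identity for `y_i`, `y_j`, `x_k`. -/
theorem kappa_commutator_y (u : ℂ) (i j k : Fin n) :
    kappa u s c i k * y j - y j * kappa u s c i k =
      kappa u s c j k * y i - y i * kappa u s c j k := by
  by_cases hij : i = j
  · rw [hij]
  by_cases hik : i = k
  · subst hik
    exact kappa_commutator_y_aux s_y c_y u i j hij
  by_cases hjk : j = k
  · subst hjk
    exact (kappa_commutator_y_aux s_y c_y u j i (Ne.symm hij)).symm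
  rw [kappa, if_neg hik, kappa, if_neg hjk, smul_mul_assoc, mul_smul_comm, smul_mul_assoc,
    mul_smul_comm, exch_mul_y s_y c_y, exch_mul_y s_y c_y,
    Equiv.swap_apply_of_ne_of_ne (Ne.symm hij) hjk, Equiv.swap_apply_of_ne_of_ne hij hik,
    sub_self, sub_self]

end

end Exchange

/-! ### Linear maps out of `ℂ[x_1, …, x_n] ⊗ U` -/

/-- The space `ℂ[x_1, …, x_n] ⊗ U`, on which the algebra will act if `ℂ S_n ⋉ C_n` and the `y_i`
act on `U`. A type of its own, whose additive group structure is the only path to its instances, so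
that its endomorphisms form a ring without unfolding of tensor product instances. -/
def Induced (n : ℕ) (U : Type) [AddCommGroup U] [Module ℂ U] : Type :=
  MvPolynomial (Fin n) ℂ ⊗[ℂ] U

noncomputable instance (n : ℕ) (U : Type) [AddCommGroup U] [Module ℂ U] :
    AddCommGroup (Induced n U) :=
  inferInstanceAs (AddCommGroup (MvPolynomial (Fin n) ℂ ⊗[ℂ] U))

noncomputable instance (n : ℕ) (U : Type) [AddCommGroup U] [Module ℂ U] :
    Module ℂ (Induced n U) :=
  inferInstanceAs (Module ℂ (MvPolynomial (Fin n) ℂ ⊗[ℂ] U))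

/-- The identity from the tensor product `ℂ[x_1, …, x_n] ⊗ U` to `Induced n U`. -/
noncomputable def Induced.equiv (n : ℕ) (U : Type) [AddCommGroup U] [Module ℂ U] :
    MvPolynomial (Fin n) ℂ ⊗[ℂ] U ≃ₗ[ℂ] Induced n U :=
  LinearEquiv.refl ℂ (MvPolynomial (Fin n) ℂ ⊗[ℂ] U)

/-- The pure tensor `p ⊗ w`, as an element of `Induced n U`. -/
noncomputable def Induced.tmul {n : ℕ} {U : Type} [AddCommGroup U] [Module ℂ U] :
    MvPolynomial (Fin n) ℂ →ₗ[ℂ] U →ₗ[ℂ] Induced n U :=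
  TensorProduct.mk ℂ (MvPolynomial (Fin n) ℂ) U

open Induced

section Extend

variable {n : ℕ} {U N : Type} [AddCommGroup U] [Module ℂ U] [AddCommGroup N] [Module ℂ N]

variable (U) in
/-- Multiplication by `x_j` on `ℂ[x_1, …, x_n] ⊗ U`. -/
noncomputable def xOp (j : Fin n) : Module.End ℂ (Induced n U) :=
  (equiv n U).conj (LinearMap.rTensor U (LinearMap.mulLeft ℂ (MvPolynomial.X j)))

/-- Linear maps on `Induced n U` agree if they agree on pure tensors. -/
theorem Induced.hom_ext {T T' : Induced n U →ₗ[ℂ] N} (h : ∀ p w, T (tmul p w) = T' (tmul p w)) :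
    T = T' :=
  TensorProduct.ext' (g := T ∘ₗ (equiv n U).toLinearMap) h

theorem xOp_tmul (j : Fin n) (p : MvPolynomial (Fin n) ℂ) (w : U) :
    xOp U j (tmul p w) = tmul (MvPolynomial.X j * p) w := rfl

theorem xOp_comm (i j : Fin n) : xOp U i * xOp U j = xOp U j * xOp U i := by
  refine Induced.hom_ext fun p w => ?_
  simp only [Module.End.mul_apply, xOp_tmul, mul_left_comm]

/-- Linear maps on `ℂ[x_1, …, x_n] ⊗ U` agree if they do so on `1 ⊗ U` and their difference
intertwines the multiplications by the `x_j` with some linear maps. -/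
theorem xOp_ext {T T' : Induced n U →ₗ[ℂ] N} (Z : Fin n → N →ₗ[ℂ] N)
    (h : ∀ j v, T (xOp U j v) - T' (xOp U j v) = Z j (T v - T' v))
    (h1 : ∀ w, T (tmul 1 w) = T' (tmul 1 w)) : T = T' := by
  refine Induced.hom_ext fun p w => sub_eq_zero.1 ?_
  induction p using MvPolynomial.induction_on with
  | C a =>
    rw [← mul_one (MvPolynomial.C a), ← MvPolynomial.smul_eq_C_mul, map_smul, LinearMap.smul_apply,
      map_smul, map_smul, h1, sub_self]
  | add p q hp hq =>
    rw [map_add, LinearMap.add_apply, map_add, map_add, add_sub_add_comm, hp, hq, add_zero]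
  | mul_X p j hp => rw [mul_comm, ← xOp_tmul, h, hp, map_zero]

/-- The linear map on `ℂ[x_1, …, x_n] ⊗ U` that restricts to `g` on `1 ⊗ U` and intertwines the
multiplications by the `x_j` with the commuting operators `M j`. -/
noncomputable def extend (M : Fin n → Module.End ℂ N) (hM : ∀ i j, M i * M j = M j * M i)
    (g : U →ₗ[ℂ] N) : Induced n U →ₗ[ℂ] N :=
  TensorProduct.lift (LinearMap.lcomp ℂ N g ∘ₗ (polyHom M hM).toLinearMap) ∘ₗ (equiv n U).symm

theorem extend_tmul (M : Fin n → Module.End ℂ N) (hM : ∀ i j, M i * M j = M j * M i)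
    (g : U →ₗ[ℂ] N) (p : MvPolynomial (Fin n) ℂ) (w : U) :
    extend M hM g (tmul p w) = polyHom M hM p (g w) := rfl

theorem extend_one_tmul (M : Fin n → Module.End ℂ N) (hM : ∀ i j, M i * M j = M j * M i)
    (g : U →ₗ[ℂ] N) (w : U) : extend M hM g (tmul 1 w) = g w := by
  rw [extend_tmul, map_one, Module.End.one_apply]

theorem extend_xOp (M : Fin n → Module.End ℂ N) (hM : ∀ i j, M i * M j = M j * M i)
    (g : U →ₗ[ℂ] N) (j : Fin n) (v : Induced n U) :
    extend M hM g (xOp U j v) = M j (extend M hM g v) := by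
  refine LinearMap.congr_fun (f := extend M hM g ∘ₗ xOp U j) (g := M j ∘ₗ extend M hM g)
    (Induced.hom_ext fun p w => ?_) v
  rw [LinearMap.comp_apply, LinearMap.comp_apply, xOp_tmul, extend_tmul, map_mul, polyHom_X,
    Module.End.mul_apply, extend_tmul]

/-- A form of `xOp_ext` in the ring of endomorphisms. -/
theorem xOp_end_ext {T T' : Module.End ℂ (Induced n U)}
    (Z : Fin n → Module.End ℂ (Induced n U))
    (h : ∀ j, T * xOp U j - T' * xOp U j = Z j * (T - T'))
    (h1 : ∀ w, T (tmul 1 w) = T' (tmul 1 w)) : T = T' :=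
  xOp_ext Z (fun j v => LinearMap.congr_fun (h j) v) h1

end Extend

/-! ### The induced module -/

section Induced

variable {n : ℕ} {U : Type} [AddCommGroup U] [Module ℂ U]
  (s : Equiv.Perm (Fin n) → Module.End ℂ U) (c y : Fin n → Module.End ℂ U)

/-- The action of `σ ∈ S_n` on `ℂ[x_1, …, x_n] ⊗ U` induced from that on `U`. -/
noncomputable def sOp (σ : Equiv.Perm (Fin n)) : Module.End ℂ (Induced n U) :=
  extend (fun j => xOp U (σ j)) (fun _ _ => xOp_comm _ _) (tmul 1 ∘ₗ s σ)

/-- The action of `c_k` on `ℂ[x_1, …, x_n] ⊗ U` induced from that on `U`. -/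
noncomputable def cOp (k : Fin n) : Module.End ℂ (Induced n U) :=
  extend (fun j => sgn k j • xOp U j)
    (fun i j => by rw [smul_mul_smul_comm, smul_mul_smul_comm, xOp_comm, mul_comm])
    (tmul 1 ∘ₗ c k)

theorem sOp_one_tmul (σ : Equiv.Perm (Fin n)) (w : U) : sOp s σ (tmul 1 w) = tmul 1 (s σ w) :=
  extend_one_tmul _ _ _ _

theorem cOp_one_tmul (k : Fin n) (w : U) : cOp c k (tmul 1 w) = tmul 1 (c k w) :=
  extend_one_tmul _ _ _ _

theorem sOp_mul_xOp (σ : Equiv.Perm (Fin n)) (j : Fin n) :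
    sOp s σ * xOp U j = xOp U (σ j) * sOp s σ :=
  LinearMap.ext fun v => extend_xOp _ _ _ j v

theorem cOp_mul_xOp (k j : Fin n) : cOp c k * xOp U j = sgn k j • (xOp U j * cOp c k) :=
  LinearMap.ext fun v => extend_xOp _ _ _ j v

variable {s c y}

theorem sgn_smul_sgn_smul {A : Type} [AddCommGroup A] (k j : Fin n) (a : A) :
    sgn k j • sgn k j • a = a := by
  unfold sgn
  split_ifs <;> simp

theorem sgn_perm (σ : Equiv.Perm (Fin n)) (k j : Fin n) : sgn (σ k) (σ j) = sgn k j := by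
  simp [sgn]

theorem xRel_xOp (h : CliffordSymRel s c) : XRel (sOp s) (cOp c) (xOp U) where
  s_one := by
    refine xOp_end_ext (xOp U) (fun j => ?_) fun w => ?_
    · rw [sOp_mul_xOp, Equiv.Perm.one_apply]
      noncomm_ring
    · rw [sOp_one_tmul, h.s_one, Module.End.one_apply, Module.End.one_apply]
  s_mul σ τ := by
    refine xOp_end_ext (fun j => xOp U (σ (τ j))) (fun j => ?_) fun w => ?_
    · rw [sOp_mul_xOp, mul_assoc, sOp_mul_xOp, ← mul_assoc, sOp_mul_xOp, Equiv.Perm.mul_apply]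
      noncomm_ring
    · rw [sOp_one_tmul, h.s_mul, Module.End.mul_apply, Module.End.mul_apply, sOp_one_tmul,
        sOp_one_tmul]
  c_sq k := by
    refine xOp_end_ext (xOp U) (fun j => ?_) fun w => ?_
    · rw [mul_assoc, cOp_mul_xOp, mul_smul_comm, ← mul_assoc, cOp_mul_xOp, smul_mul_assoc,
        sgn_smul_sgn_smul]
      noncomm_ring
    · rw [Module.End.mul_apply, cOp_one_tmul, cOp_one_tmul, ← Module.End.mul_apply, h.c_sq,
        Module.End.one_apply, Module.End.one_apply]
  c_c i k hik := by
    refine xOp_end_ext (fun j => sgn i j • sgn k j • xOp U j) (fun j => ?_) fun w => ?_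
    · rw [neg_mul, mul_assoc, cOp_mul_xOp, mul_smul_comm, ← mul_assoc, cOp_mul_xOp, smul_mul_assoc,
        mul_assoc (cOp c k), cOp_mul_xOp, mul_smul_comm, ← mul_assoc, cOp_mul_xOp, smul_mul_assoc,
        smul_comm (sgn k j), smul_mul_assoc, smul_mul_assoc, ← smul_neg, ← smul_neg, ← smul_sub,
        ← smul_sub]
      noncomm_ring
    · rw [Module.End.mul_apply, LinearMap.neg_apply, Module.End.mul_apply, cOp_one_tmul,
        cOp_one_tmul, cOp_one_tmul, cOp_one_tmul, ← Module.End.mul_apply, h.c_c i k hik,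
        LinearMap.neg_apply, map_neg, Module.End.mul_apply]
  s_c σ k := by
    refine xOp_end_ext (fun j => sgn k j • xOp U (σ j)) (fun j => ?_) fun w => ?_
    · rw [mul_assoc, cOp_mul_xOp, mul_smul_comm, ← mul_assoc, sOp_mul_xOp, mul_assoc (cOp c (σ k)),
        sOp_mul_xOp, ← mul_assoc, cOp_mul_xOp, sgn_perm, smul_mul_assoc, smul_mul_assoc, ← smul_sub]
      noncomm_ring
    · rw [Module.End.mul_apply, Module.End.mul_apply, cOp_one_tmul, sOp_one_tmul, sOp_one_tmul,
        cOp_one_tmul, ← Module.End.mul_apply, h.s_c, Module.End.mul_apply]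
  x_comm := xOp_comm
  s_x := sOp_mul_xOp s
  c_x := cOp_mul_xOp c

variable (s c) in
/-- The operator `(v, w) ↦ (x_j v + [y_i, x_j] w, x_j w)`. A linear map `G` into the square of the
module whose second component is the identity intertwines `x_j` with this operator exactly if its
first component has the commutator with `x_j` that is prescribed for `y_i`. -/
noncomputable def pairOp (u : ℂ) (i j : Fin n) :
    Module.End ℂ ((Induced n U) × (Induced n U)) :=
  LinearMap.prod
    (xOp U j ∘ₗ LinearMap.fst ℂ _ _ + kappa u (sOp s) (cOp c) i j ∘ₗ LinearMap.snd ℂ _ _)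
    (xOp U j ∘ₗ LinearMap.snd ℂ _ _)

theorem pairOp_comm (h : CliffordSymRel s c) (u : ℂ) (i j k : Fin n) :
    pairOp s c u i j * pairOp s c u i k = pairOp s c u i k * pairOp s c u i j := by
  have hx : ∀ v : Induced n U, xOp U j (xOp U k v) = xOp U k (xOp U j v) :=
    LinearMap.congr_fun (xOp_comm j k)
  refine LinearMap.ext fun ⟨v, w⟩ => Prod.ext ?_ (hx w)
  have h1 := LinearMap.congr_fun ((xRel_xOp h).kappa_commutator_x u i j k) w
  simp only [LinearMap.sub_apply, Module.End.mul_apply] at h1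
  change xOp U j (xOp U k v + kappa u (sOp s) (cOp c) i k w) +
      kappa u (sOp s) (cOp c) i j (xOp U k w) =
    xOp U k (xOp U j v + kappa u (sOp s) (cOp c) i j w) + kappa u (sOp s) (cOp c) i k (xOp U j w)
  rw [map_add, map_add, hx v, add_assoc, add_assoc, add_right_inj, ← sub_eq_zero]
  rw [← sub_eq_zero] at h1
  rw [← h1]
  abel

variable (y) in
/-- The map `v ↦ (y_i v, v)` on `ℂ[x_1, …, x_n] ⊗ U`. -/
noncomputable def yPair (h : CliffordSymRel s c) (u : ℂ) (i : Fin n) :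
    Induced n U →ₗ[ℂ]
      (Induced n U) × (Induced n U) :=
  extend (pairOp s c u i) (pairOp_comm h u i)
    (LinearMap.prod (tmul 1 ∘ₗ y i) (tmul 1))

variable (y) in
/-- The action of `y_i` on `ℂ[x_1, …, x_n] ⊗ U` induced from that on `U`. -/
noncomputable def yOp (h : CliffordSymRel s c) (u : ℂ) (i : Fin n) :
    Module.End ℂ (Induced n U) :=
  LinearMap.fst ℂ _ _ ∘ₗ yPair y h u i

theorem yPair_snd (h : CliffordSymRel s c) (u : ℂ) (i : Fin n) :
    LinearMap.snd ℂ _ _ ∘ₗ yPair y h u i = LinearMap.id := by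
  refine xOp_ext (xOp U) (fun j v => ?_) fun w => ?_
  · rw [LinearMap.comp_apply, yPair, extend_xOp, map_sub]
    rfl
  · rw [LinearMap.comp_apply, yPair, extend_one_tmul]
    rfl

theorem yOp_one_tmul (h : CliffordSymRel s c) (u : ℂ) (i : Fin n) (w : U) :
    yOp y h u i (tmul 1 w) = tmul 1 (y i w) := by
  rw [yOp, LinearMap.comp_apply, yPair, extend_one_tmul]
  rfl

theorem yOp_mul_xOp (h : CliffordSymRel s c) (u : ℂ) (i j : Fin n) :
    yOp y h u i * xOp U j = xOp U j * yOp y h u i + kappa u (sOp s) (cOp c) i j := by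
  refine LinearMap.ext fun v => ?_
  have h1 : (yPair y h u i v).2 = v := LinearMap.congr_fun (yPair_snd h u i) v
  have h2 : yPair y h u i (xOp U j v) = pairOp s c u i j (yPair y h u i v) := extend_xOp _ _ _ j v
  rw [Module.End.mul_apply, yOp, LinearMap.comp_apply, h2]
  change xOp U j _ + kappa u (sOp s) (cOp c) i j (yPair y h u i v).2 = _
  rw [h1]
  rfl

theorem sOp_mul_yOp (h : CliffordSymRel s c) (hy : YRel s c y) (u : ℂ) (σ : Equiv.Perm (Fin n))
    (i : Fin n) : sOp s σ * yOp y h u i = yOp y h u (σ i) * sOp s σ := by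
  refine xOp_end_ext (fun j => xOp U (σ j)) (fun j => ?_) fun w => ?_
  · rw [mul_assoc, yOp_mul_xOp, mul_assoc, sOp_mul_xOp, mul_add, ← mul_assoc, sOp_mul_xOp,
      ← mul_assoc, yOp_mul_xOp, add_mul, (xRel_xOp h).s_mul_kappa]
    noncomm_ring
  · rw [Module.End.mul_apply, Module.End.mul_apply, yOp_one_tmul, sOp_one_tmul, sOp_one_tmul,
      yOp_one_tmul, ← Module.End.mul_apply, hy.s_y, Module.End.mul_apply]

theorem cOp_mul_yOp (h : CliffordSymRel s c) (hy : YRel s c y) (u : ℂ) (k i : Fin n) :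
    cOp c k * yOp y h u i = yOp y h u i * cOp c k := by
  refine xOp_end_ext (fun j => sgn k j • xOp U j) (fun j => ?_) fun w => ?_
  · rw [mul_assoc, yOp_mul_xOp, mul_assoc, cOp_mul_xOp, mul_add, ← mul_assoc, cOp_mul_xOp,
      mul_smul_comm, ← mul_assoc, yOp_mul_xOp, add_mul, (xRel_xOp h).c_mul_kappa, smul_mul_assoc,
      ← smul_add, ← smul_sub, smul_mul_assoc]
    noncomm_ring
  · rw [Module.End.mul_apply, Module.End.mul_apply, yOp_one_tmul, cOp_one_tmul, cOp_one_tmul,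
      yOp_one_tmul, ← Module.End.mul_apply, hy.c_y, Module.End.mul_apply]

theorem yRel_yOp (h : CliffordSymRel s c) (hy : YRel s c y) (u : ℂ) :
    YRel (sOp s) (cOp c) (yOp y h u) where
  s_y := sOp_mul_yOp h hy u
  c_y := cOp_mul_yOp h hy u
  y_comm i k := by
    refine xOp_end_ext (xOp U) (fun j => ?_) fun w => ?_
    · have h1 := kappa_commutator_y (sOp_mul_yOp h hy u) (cOp_mul_yOp h hy u) u i k j
      rw [mul_assoc, yOp_mul_xOp, mul_add, ← mul_assoc, yOp_mul_xOp, mul_assoc (yOp y h u k),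
        yOp_mul_xOp, mul_add, ← mul_assoc, yOp_mul_xOp, add_mul, add_mul]
      rw [← sub_eq_zero] at h1 ⊢
      rw [← h1]
      noncomm_ring
    · rw [Module.End.mul_apply, Module.End.mul_apply, yOp_one_tmul, yOp_one_tmul, yOp_one_tmul,
        yOp_one_tmul, ← Module.End.mul_apply, hy.y_comm, Module.End.mul_apply]

end Induced

open Induced

/-! ### Homomorphisms out of the algebra -/

section Lift

variable {n : ℕ} {u : ℂ} {R : Type} [Ring R] [Algebra ℂ R]

/-- The values of a homomorphism on the generators, from its values on the four families. -/
def onGen (s : Equiv.Perm (Fin n) → R) (c x y : Fin n → R) : Gen n → R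
  | .x i => x i
  | .y i => y i
  | .c i => c i
  | .s σ => s σ

/-- The algebra homomorphism out of the rational double affine Hecke-Clifford algebra given by
elements of an algebra that satisfy its relations. -/
noncomputable def liftHom {s : Equiv.Perm (Fin n) → R} {c x y : Fin n → R} (hx : XRel s c x)
    (hy : YRel s c y) (hyx : ∀ i j, y i * x j = x j * y i + kappa u s c i j) : DAHCa n u →ₐ[ℂ] R :=
  RingQuot.liftAlgHom ℂ ⟨FreeAlgebra.lift ℂ (onGen s c x y), by
    intro a b hab
    induction hab with
    | s_one => simpa [onGen] using hx.s_one
    | s_mul σ τ => simpa [onGen] using hx.s_mul σ τ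
    | x_comm i j => simpa [onGen] using hx.x_comm i j
    | y_comm i j => simpa [onGen] using hy.y_comm i j
    | s_x σ i => simpa [onGen] using hx.s_x σ i
    | s_y σ i => simpa [onGen] using hy.s_y σ i
    | c_x_self i => simpa [onGen, sgn] using hx.c_x i i
    | c_y_self i => simpa [onGen] using hy.c_y i i
    | c_x i j h => simpa [onGen, sgn, Ne.symm h] using hx.c_x j i
    | c_y i j h => simpa [onGen] using hy.c_y j i
    | s_c σ i => simpa [onGen] using hx.s_c σ i
    | c_sq i => simpa [onGen, pow_two] using hx.c_sq i
    | c_c i j h => simpa [onGen] using hx.c_c i j h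
    | y_x i j h =>
      simp [onGen, hyx, kappa, exch, Ne.symm h, Equiv.swap_comm i j]
    | y_x_self i => simp [onGen, hyx, kappa, exch]⟩

section

variable {s : Equiv.Perm (Fin n) → R} {c x y : Fin n → R} (hx : XRel s c x)
    (hy : YRel s c y) (hyx : ∀ i j, y i * x j = x j * y i + kappa u s c i j)

theorem liftHom_mk (g : Gen n) :
    liftHom hx hy hyx (DAHCa.mk n u (FreeAlgebra.ι ℂ g)) = onGen s c x y g :=
  (RingQuot.liftAlgHom_mkAlgHom_apply ℂ _ _ _).trans (FreeAlgebra.lift_ι_apply _ _)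

theorem liftHom_x (i : Fin n) : liftHom hx hy hyx (DAHCa.x u i) = x i := liftHom_mk hx hy hyx _
theorem liftHom_y (i : Fin n) : liftHom hx hy hyx (DAHCa.y u i) = y i := liftHom_mk hx hy hyx _
theorem liftHom_c (i : Fin n) : liftHom hx hy hyx (DAHCa.c u i) = c i := liftHom_mk hx hy hyx _
theorem liftHom_s (σ : Equiv.Perm (Fin n)) : liftHom hx hy hyx (DAHCa.s u σ) = s σ :=
  liftHom_mk hx hy hyx _

end

theorem xRel_DAHCa (n : ℕ) (u : ℂ) :
    XRel (DAHCa.s (n := n) u) (DAHCa.c u) (DAHCa.x u) where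
  s_one := (DAHCa.sHom n u).map_one
  s_mul := (DAHCa.sHom n u).map_mul
  c_sq := DAHCa.c_mul_self u
  c_c := DAHCa.c_anticomm u
  s_c σ i := by simpa [DAHCa.s, DAHCa.c] using DAHCa.mk_rel (u := u) (Rel.s_c σ i)
  x_comm := DAHCa.x_comm u
  s_x σ i := by simpa [DAHCa.s, DAHCa.x] using DAHCa.mk_rel (u := u) (Rel.s_x σ i)
  c_x k j := by
    by_cases h : k = j
    · subst h
      simpa [DAHCa.c, DAHCa.x, sgn] using DAHCa.mk_rel (u := u) (Rel.c_x_self k)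
    · simpa [DAHCa.c, DAHCa.x, sgn, h] using DAHCa.mk_rel (u := u) (Rel.c_x j k (Ne.symm h))

theorem yRel_DAHCa (n : ℕ) (u : ℂ) :
    YRel (DAHCa.s (n := n) u) (DAHCa.c u) (DAHCa.y u) where
  y_comm := DAHCa.y_comm u
  s_y σ i := by simpa [DAHCa.s, DAHCa.y] using DAHCa.mk_rel (u := u) (Rel.s_y σ i)
  c_y k j := by
    by_cases h : k = j
    · subst h
      simpa [DAHCa.c, DAHCa.y] using DAHCa.mk_rel (u := u) (Rel.c_y_self k)
    · simpa [DAHCa.c, DAHCa.y] using DAHCa.mk_rel (u := u) (Rel.c_y j k (Ne.symm h))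

theorem y_mul_x_DAHCa (i j : Fin n) : DAHCa.y u i * DAHCa.x u j =
    DAHCa.x u j * DAHCa.y u i + kappa u (DAHCa.s u) (DAHCa.c u) i j := by
  rw [← sub_eq_iff_eq_add']
  by_cases h : i = j
  · subst h
    simpa [DAHCa.s, DAHCa.c, DAHCa.x, DAHCa.y, kappa, exch]
      using DAHCa.mk_rel (u := u) (Rel.y_x_self i)
  · simpa [DAHCa.s, DAHCa.c, DAHCa.x, DAHCa.y, kappa, exch, h, Equiv.swap_comm j i]
      using DAHCa.mk_rel (u := u) (Rel.y_x j i (Ne.symm h))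

end Lift

/-! ### The regular module of `ℂ[y_1, …, y_n] ⋊ (ℂ S_n ⋉ C_n)` -/

section Regular

/-- The algebra `C_n ⊗ ℂ[y_1, …, y_n]`, in which the `c_i` and the `y_i` commute. -/
def CliffPoly (n : ℕ) : Type := Cliff n ⊗[ℂ] MvPolynomial (Fin n) ℂ

noncomputable instance (n : ℕ) : Ring (CliffPoly n) :=
  inferInstanceAs (Ring (Cliff n ⊗[ℂ] MvPolynomial (Fin n) ℂ))

noncomputable instance (n : ℕ) : Algebra ℂ (CliffPoly n) :=
  inferInstanceAs (Algebra ℂ (Cliff n ⊗[ℂ] MvPolynomial (Fin n) ℂ))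

namespace CliffPoly

variable {n : ℕ}

/-- The identity from the tensor product `C_n ⊗ ℂ[y_1, …, y_n]` to `CliffPoly n`. -/
noncomputable def equiv (n : ℕ) : Cliff n ⊗[ℂ] MvPolynomial (Fin n) ℂ ≃ₗ[ℂ] CliffPoly n :=
  LinearEquiv.refl ℂ (Cliff n ⊗[ℂ] MvPolynomial (Fin n) ℂ)

/-- The inclusion of `C_n`. -/
noncomputable def inl (n : ℕ) : Cliff n →ₐ[ℂ] CliffPoly n :=
  Algebra.TensorProduct.includeLeft (R := ℂ) (S := ℂ) (A := Cliff n) (B := MvPolynomial (Fin n) ℂ)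

/-- The inclusion of `ℂ[y_1, …, y_n]`. -/
noncomputable def inr (n : ℕ) : MvPolynomial (Fin n) ℂ →ₐ[ℂ] CliffPoly n :=
  Algebra.TensorProduct.includeRight (R := ℂ) (A := Cliff n) (B := MvPolynomial (Fin n) ℂ)

theorem equiv_tmul (a : Cliff n) (q : MvPolynomial (Fin n) ℂ) :
    equiv n (a ⊗ₜ q) = inl n a * inr n q := by
  refine Eq.symm ((Algebra.TensorProduct.tmul_mul_tmul a 1 1 q).trans ?_)
  rw [mul_one, one_mul]
  rfl

theorem inl_inr_comm (a : Cliff n) (q : MvPolynomial (Fin n) ℂ) :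
    inl n a * inr n q = inr n q * inl n a := by
  rw [← equiv_tmul]
  refine Eq.symm ((Algebra.TensorProduct.tmul_mul_tmul 1 a q 1).trans ?_)
  rw [mul_one, one_mul]
  rfl

theorem hom_ext {N : Type} [AddCommGroup N] [Module ℂ N] {T T' : CliffPoly n →ₗ[ℂ] N}
    (h : ∀ a q, T (inl n a * inr n q) = T' (inl n a * inr n q)) : T = T' := by
  refine TensorProduct.ext' (g := T ∘ₗ (equiv n).toLinearMap) (h := T' ∘ₗ (equiv n).toLinearMap)
    fun a q => ?_
  have h1 := h a q
  rwa [← equiv_tmul] at h1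

end CliffPoly

open CliffPoly

theorem Cliff.c_sq {n : ℕ} (i : Fin n) : Cliff.c i * Cliff.c i = 1 := by
  have h : cliffordForm n (Pi.single i 1) = 1 := by
    simp [cliffordForm, QuadraticMap.weightedSumSquares_apply, Pi.single_apply]
  rw [Cliff.c, CliffordAlgebra.ι_sq_scalar, h, map_one]

theorem Cliff.c_anticomm {n : ℕ} (i j : Fin n) (h : i ≠ j) :
    Cliff.c i * Cliff.c j = -(Cliff.c j * Cliff.c i) := by
  refine CliffordAlgebra.ι_mul_ι_comm_of_isOrtho ?_
  simp only [QuadraticMap.IsOrtho, cliffordForm, QuadraticMap.weightedSumSquares_apply,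
    ← Finset.sum_add_distrib]
  refine Finset.sum_congr rfl fun k _ => ?_
  by_cases hk : k = i
  · subst hk
    simp [h]
  · simp [hk]

/-- An induction principle for the Clifford algebra with the generators `c_i`. -/
theorem Cliff.induction {n : ℕ} {C : Cliff n → Prop} (scalar : ∀ r, C (algebraMap ℂ (Cliff n) r))
    (c : ∀ i, C (Cliff.c i)) (mul : ∀ a b, C a → C b → C (a * b))
    (add : ∀ a b, C a → C b → C (a + b)) (a : Cliff n) : C a := by
  refine CliffordAlgebra.induction scalar (fun v => ?_) (fun a b => mul a b) (fun a b => add a b) a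
  rw [← Finset.univ_sum_single v, map_sum]
  refine Finset.sum_induction _ C (fun a b => add a b) (by simpa using scalar 0) fun i _ => ?_
  have hi : (Pi.single i (v i) : Fin n → ℂ) = v i • Pi.single i 1 := by
    rw [← Pi.single_smul, smul_eq_mul, mul_one]
  rw [hi, map_smul, Algebra.smul_def]
  exact mul _ _ (scalar _) (c i)

/-- The space `ℂ S_n ⊗ C_n ⊗ ℂ[y_1, …, y_n]`, as functions on `S_n`: the element
`σ ⊗ m` is the function with value `m` at `σ` and `0` elsewhere. -/
abbrev RegMod (n : ℕ) : Type := Equiv.Perm (Fin n) → CliffPoly n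

namespace RegMod

variable {n : ℕ}

/-- The action of `τ`, which sends `σ ⊗ m` to `τσ ⊗ m`. -/
noncomputable def s (τ : Equiv.Perm (Fin n)) : Module.End ℂ (RegMod n) :=
  LinearMap.funLeft ℂ (CliffPoly n) fun σ => τ⁻¹ * σ

/-- The action of `c_i`, which sends `σ ⊗ m` to `c_i σ ⊗ m = σ ⊗ c_{σ⁻¹ i} m`. -/
noncomputable def c (i : Fin n) : Module.End ℂ (RegMod n) :=
  LinearMap.mulLeft ℂ fun σ => inl n (Cliff.c (σ⁻¹ i))

/-- The action of `y_i`, which sends `σ ⊗ m` to `y_i σ ⊗ m = σ ⊗ y_{σ⁻¹ i} m`. -/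
noncomputable def y (i : Fin n) : Module.End ℂ (RegMod n) :=
  LinearMap.mulLeft ℂ fun σ => inr n (MvPolynomial.X (σ⁻¹ i))

theorem s_apply (τ σ : Equiv.Perm (Fin n)) (f : RegMod n) : s τ f σ = f (τ⁻¹ * σ) := rfl

theorem c_apply (i : Fin n) (σ : Equiv.Perm (Fin n)) (f : RegMod n) :
    c i f σ = inl n (Cliff.c (σ⁻¹ i)) * f σ := rfl

theorem y_apply (i : Fin n) (σ : Equiv.Perm (Fin n)) (f : RegMod n) :
    y i f σ = inr n (MvPolynomial.X (σ⁻¹ i)) * f σ := rfl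

theorem s_single (τ σ : Equiv.Perm (Fin n)) (m : CliffPoly n) :
    s τ (Pi.single σ m) = Pi.single (τ * σ) m := by
  funext ρ
  simp [s_apply, Pi.single_apply, inv_mul_eq_iff_eq_mul]

theorem c_single_one (i : Fin n) (m : CliffPoly n) :
    c i (Pi.single 1 m) = Pi.single 1 (inl n (Cliff.c i) * m) := by
  funext σ
  rw [c_apply]
  by_cases h : σ = 1
  · subst h
    simp
  · simp [h]

theorem y_single_one (i : Fin n) (m : CliffPoly n) :
    y i (Pi.single 1 m) = Pi.single 1 (inr n (MvPolynomial.X i) * m) := by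
  funext σ
  rw [y_apply]
  by_cases h : σ = 1
  · subst h
    simp
  · simp [h]

theorem cliffordSymRel (n : ℕ) : CliffordSymRel (s (n := n)) c where
  s_one := by
    refine LinearMap.ext fun f => funext fun σ => ?_
    simp [s_apply]
  s_mul τ τ' := by
    refine LinearMap.ext fun f => funext fun σ => ?_
    simp [s_apply, mul_assoc]
  c_sq i := by
    refine LinearMap.ext fun f => funext fun σ => ?_
    simp [c_apply, ← mul_assoc, ← map_mul, Cliff.c_sq]
  c_c i j h := by
    refine LinearMap.ext fun f => funext fun σ => ?_
    rw [Module.End.mul_apply, LinearMap.neg_apply, Pi.neg_apply, Module.End.mul_apply, c_apply,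
      c_apply, c_apply, c_apply, ← mul_assoc, ← map_mul,
      Cliff.c_anticomm _ _ ((Equiv.injective _).ne h), map_neg, map_mul, neg_mul, mul_assoc]
  s_c τ i := by
    refine LinearMap.ext fun f => funext fun σ => ?_
    simp [s_apply, c_apply]

theorem yRel (n : ℕ) : YRel (s (n := n)) c y where
  y_comm i j := by
    refine LinearMap.ext fun f => funext fun σ => ?_
    simp only [Module.End.mul_apply, y_apply]
    rw [← mul_assoc, ← mul_assoc, ← map_mul, mul_comm, map_mul]
  s_y τ i := by
    refine LinearMap.ext fun f => funext fun σ => ?_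
    simp [s_apply, y_apply]
  c_y k i := by
    refine LinearMap.ext fun f => funext fun σ => ?_
    simp only [Module.End.mul_apply, c_apply, y_apply]
    rw [← mul_assoc, inl_inr_comm, mul_assoc]

end RegMod

end Regular

/-! ### The action on `ℂ[x_1, …, x_n] ⊗ ℂ S_n ⊗ C_n ⊗ ℂ[y_1, …, y_n]` -/

section PBW

open CliffPoly

variable {n : ℕ}

/-- The action of the algebra on `ℂ[x_1, …, x_n] ⊗ ℂ S_n ⊗ C_n ⊗ ℂ[y_1, …, y_n]`. -/
noncomputable def action (n : ℕ) (u : ℂ) : DAHCa n u →ₐ[ℂ] Module.End ℂ (Induced n (RegMod n)) :=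
  liftHom (xRel_xOp (RegMod.cliffordSymRel n))
    (yRel_yOp (RegMod.cliffordSymRel n) (RegMod.yRel n) u) (yOp_mul_xOp _ u)

theorem action_x (u : ℂ) (i : Fin n) : action n u (DAHCa.x u i) = xOp (RegMod n) i :=
  liftHom_x _ _ _ i

theorem action_y (u : ℂ) (i : Fin n) :
    action n u (DAHCa.y u i) = yOp RegMod.y (RegMod.cliffordSymRel n) u i :=
  liftHom_y _ _ _ i

theorem action_c (u : ℂ) (i : Fin n) : action n u (DAHCa.c u i) = cOp RegMod.c i :=
  liftHom_c _ _ _ i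

theorem action_s (u : ℂ) (σ : Equiv.Perm (Fin n)) : action n u (DAHCa.s u σ) = sOp RegMod.s σ :=
  liftHom_s _ _ _ σ

/-- The linear map `a ⊗ q ↦ a q` from `C_n ⊗ ℂ[y_1, …, y_n]` to the algebra. -/
noncomputable def mulCliffPoly (n : ℕ) (u : ℂ) : CliffPoly n →ₗ[ℂ] DAHCa n u :=
  LinearMap.mul' ℂ (DAHCa n u) ∘ₗ
    TensorProduct.map (DAHCa.cliff n u).toLinearMap (DAHCa.polyY n u).toLinearMap ∘ₗ
      (CliffPoly.equiv n).symm.toLinearMap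

theorem mulCliffPoly_apply (u : ℂ) (a : Cliff n) (q : MvPolynomial (Fin n) ℂ) :
    mulCliffPoly n u (inl n a * inr n q) = DAHCa.cliff n u a * DAHCa.polyY n u q := by
  rw [← equiv_tmul]
  rfl

theorem y_mul_cliff (u : ℂ) (i : Fin n) (a : Cliff n) :
    DAHCa.y u i * DAHCa.cliff n u a = DAHCa.cliff n u a * DAHCa.y u i := by
  induction a using Cliff.induction with
  | scalar r => rw [AlgHom.commutes, Algebra.commutes]
  | c k => rw [DAHCa.cliff_c, (yRel_DAHCa n u).c_y]
  | mul a b ha hb => rw [map_mul, ← mul_assoc, ha, mul_assoc, hb, mul_assoc]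
  | add a b ha hb => rw [map_add, mul_add, add_mul, ha, hb]

theorem c_mul_mulCliffPoly (u : ℂ) (k : Fin n) (m : CliffPoly n) :
    DAHCa.c u k * mulCliffPoly n u m = mulCliffPoly n u (inl n (Cliff.c k) * m) := by
  refine LinearMap.congr_fun (f := LinearMap.mulLeft ℂ (DAHCa.c u k) ∘ₗ mulCliffPoly n u)
    (g := mulCliffPoly n u ∘ₗ LinearMap.mulLeft ℂ (inl n (Cliff.c k)))
    (CliffPoly.hom_ext fun a q => ?_) m
  rw [LinearMap.comp_apply, LinearMap.comp_apply, LinearMap.mulLeft_apply, LinearMap.mulLeft_apply,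
    ← mul_assoc, ← map_mul, mulCliffPoly_apply, mulCliffPoly_apply, map_mul, DAHCa.cliff_c,
    mul_assoc]

theorem y_mul_mulCliffPoly (u : ℂ) (k : Fin n) (m : CliffPoly n) :
    DAHCa.y u k * mulCliffPoly n u m = mulCliffPoly n u (inr n (MvPolynomial.X k) * m) := by
  refine LinearMap.congr_fun (f := LinearMap.mulLeft ℂ (DAHCa.y u k) ∘ₗ mulCliffPoly n u)
    (g := mulCliffPoly n u ∘ₗ LinearMap.mulLeft ℂ (inr n (MvPolynomial.X k)))
    (CliffPoly.hom_ext fun a q => ?_) m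
  rw [LinearMap.comp_apply, LinearMap.comp_apply, LinearMap.mulLeft_apply, LinearMap.mulLeft_apply,
    ← mul_assoc, ← inl_inr_comm, mul_assoc (inl n a), ← map_mul, mulCliffPoly_apply,
    mulCliffPoly_apply, map_mul, DAHCa.polyY_X, ← mul_assoc, y_mul_cliff, mul_assoc]

/-- The linear map `σ ⊗ a ⊗ q ↦ σ a q` from `ℂ S_n ⊗ C_n ⊗ ℂ[y_1, …, y_n]` to the algebra. -/
noncomputable def mulReg (n : ℕ) (u : ℂ) : RegMod n →ₗ[ℂ] DAHCa n u :=
  ∑ σ, LinearMap.mulLeft ℂ (DAHCa.s u σ) ∘ₗ mulCliffPoly n u ∘ₗ LinearMap.proj σ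

theorem mulReg_apply (u : ℂ) (f : RegMod n) :
    mulReg n u f = ∑ σ, DAHCa.s u σ * mulCliffPoly n u (f σ) := by
  simp [mulReg]

theorem s_mul_mulReg (u : ℂ) (τ : Equiv.Perm (Fin n)) (f : RegMod n) :
    DAHCa.s u τ * mulReg n u f = mulReg n u (RegMod.s τ f) := by
  rw [mulReg_apply, mulReg_apply, Finset.mul_sum]
  refine Fintype.sum_equiv (Equiv.mulLeft τ) _ _ fun σ => ?_
  rw [Equiv.coe_mulLeft, RegMod.s_apply, inv_mul_cancel_left, ← mul_assoc,
    ← (xRel_DAHCa n u).s_mul]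

theorem c_mul_mulReg (u : ℂ) (k : Fin n) (f : RegMod n) :
    DAHCa.c u k * mulReg n u f = mulReg n u (RegMod.c k f) := by
  rw [mulReg_apply, mulReg_apply, Finset.mul_sum]
  refine Finset.sum_congr rfl fun σ _ => ?_
  rw [RegMod.c_apply, ← c_mul_mulCliffPoly, ← mul_assoc, ← mul_assoc, (xRel_DAHCa n u).s_c,
    ← Equiv.Perm.mul_apply, mul_inv_cancel,
    Equiv.Perm.one_apply]

theorem y_mul_mulReg (u : ℂ) (k : Fin n) (f : RegMod n) :
    DAHCa.y u k * mulReg n u f = mulReg n u (RegMod.y k f) := by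
  rw [mulReg_apply, mulReg_apply, Finset.mul_sum]
  refine Finset.sum_congr rfl fun σ _ => ?_
  rw [RegMod.y_apply, ← y_mul_mulCliffPoly, ← mul_assoc, ← mul_assoc, (yRel_DAHCa n u).s_y,
    ← Equiv.Perm.mul_apply, mul_inv_cancel,
    Equiv.Perm.one_apply]

/-- The linear map `p ⊗ σ ⊗ a ⊗ q ↦ p σ a q` to the algebra. -/
noncomputable def mulMap (n : ℕ) (u : ℂ) : Induced n (RegMod n) →ₗ[ℂ] DAHCa n u :=
  TensorProduct.lift
    ((LinearMap.mul ℂ (DAHCa n u) ∘ₗ (DAHCa.polyX n u).toLinearMap).compl₂ (mulReg n u)) ∘ₗ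
      (Induced.equiv n (RegMod n)).symm.toLinearMap

theorem mulMap_tmul (u : ℂ) (p : MvPolynomial (Fin n) ℂ) (w : RegMod n) :
    mulMap n u (tmul p w) = DAHCa.polyX n u p * mulReg n u w := rfl

theorem mulMap_one_tmul (u : ℂ) (w : RegMod n) : mulMap n u (tmul 1 w) = mulReg n u w := by
  rw [mulMap_tmul, map_one, one_mul]

theorem mulMap_xOp (u : ℂ) (j : Fin n) (v : Induced n (RegMod n)) :
    mulMap n u (xOp (RegMod n) j v) = DAHCa.x u j * mulMap n u v := by
  refine LinearMap.congr_fun (f := mulMap n u ∘ₗ xOp (RegMod n) j)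
    (g := LinearMap.mulLeft ℂ (DAHCa.x u j) ∘ₗ mulMap n u) (Induced.hom_ext fun p w => ?_) v
  rw [LinearMap.comp_apply, LinearMap.comp_apply, LinearMap.mulLeft_apply, xOp_tmul, mulMap_tmul,
    mulMap_tmul, map_mul, DAHCa.polyX_X, mul_assoc]

theorem mulMap_sOp (u : ℂ) (τ : Equiv.Perm (Fin n)) (v : Induced n (RegMod n)) :
    mulMap n u (sOp RegMod.s τ v) = DAHCa.s u τ * mulMap n u v := by
  refine LinearMap.congr_fun (f := mulMap n u ∘ₗ sOp RegMod.s τ)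
    (g := LinearMap.mulLeft ℂ (DAHCa.s u τ) ∘ₗ mulMap n u)
    (xOp_ext (fun j => LinearMap.mulLeft ℂ (DAHCa.x u (τ j))) (fun j v => ?_) fun w => ?_) v
  · simp only [LinearMap.comp_apply, LinearMap.mulLeft_apply]
    rw [mulMap_xOp, ← Module.End.mul_apply, sOp_mul_xOp, Module.End.mul_apply, mulMap_xOp,
      ← mul_assoc, (xRel_DAHCa n u).s_x, mul_assoc, ← mul_sub]
  · simp only [LinearMap.comp_apply, LinearMap.mulLeft_apply]
    rw [sOp_one_tmul, mulMap_one_tmul, mulMap_one_tmul, s_mul_mulReg]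

theorem mulMap_cOp (u : ℂ) (k : Fin n) (v : Induced n (RegMod n)) :
    mulMap n u (cOp RegMod.c k v) = DAHCa.c u k * mulMap n u v := by
  refine LinearMap.congr_fun (f := mulMap n u ∘ₗ cOp RegMod.c k)
    (g := LinearMap.mulLeft ℂ (DAHCa.c u k) ∘ₗ mulMap n u)
    (xOp_ext (fun j => sgn k j • LinearMap.mulLeft ℂ (DAHCa.x u j)) (fun j v => ?_) fun w => ?_) v
  · simp only [LinearMap.comp_apply, LinearMap.mulLeft_apply, LinearMap.smul_apply]
    rw [mulMap_xOp, ← Module.End.mul_apply, cOp_mul_xOp, LinearMap.smul_apply, map_zsmul,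
      Module.End.mul_apply, mulMap_xOp, ← mul_assoc, (xRel_DAHCa n u).c_x, smul_mul_assoc,
      mul_assoc, ← smul_sub, ← mul_sub]
  · simp only [LinearMap.comp_apply, LinearMap.mulLeft_apply]
    rw [cOp_one_tmul, mulMap_one_tmul, mulMap_one_tmul, c_mul_mulReg]

theorem mulMap_exch (u : ℂ) (i j : Fin n) (v : Induced n (RegMod n)) :
    mulMap n u (exch (sOp RegMod.s) (cOp RegMod.c) i j v) =
      exch (DAHCa.s u) (DAHCa.c u) i j * mulMap n u v := by
  unfold exch
  rw [Module.End.mul_apply, LinearMap.add_apply, Module.End.one_apply, Module.End.mul_apply,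
    map_add, mulMap_cOp, mulMap_cOp, mulMap_sOp, add_mul, add_mul, one_mul, mul_assoc, mul_assoc]

theorem mulMap_kappa (u : ℂ) (i j : Fin n) (v : Induced n (RegMod n)) :
    mulMap n u (kappa u (sOp RegMod.s) (cOp RegMod.c) i j v) =
      kappa u (DAHCa.s u) (DAHCa.c u) i j * mulMap n u v := by
  unfold kappa
  split_ifs
  · rw [LinearMap.neg_apply, LinearMap.smul_apply, LinearMap.sum_apply, map_neg, map_smul, map_sum,
      neg_mul, smul_mul_assoc, Finset.sum_mul]
    simp only [mulMap_exch]
  · rw [LinearMap.smul_apply, map_smul, mulMap_exch, smul_mul_assoc]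

theorem mulMap_yOp (u : ℂ) (i : Fin n) (v : Induced n (RegMod n)) :
    mulMap n u (yOp RegMod.y (RegMod.cliffordSymRel n) u i v) = DAHCa.y u i * mulMap n u v := by
  refine LinearMap.congr_fun (f := mulMap n u ∘ₗ yOp RegMod.y (RegMod.cliffordSymRel n) u i)
    (g := LinearMap.mulLeft ℂ (DAHCa.y u i) ∘ₗ mulMap n u)
    (xOp_ext (fun j => LinearMap.mulLeft ℂ (DAHCa.x u j)) (fun j v => ?_) fun w => ?_) v
  · simp only [LinearMap.comp_apply, LinearMap.mulLeft_apply]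
    rw [mulMap_xOp, ← Module.End.mul_apply, yOp_mul_xOp, LinearMap.add_apply, map_add,
      mulMap_kappa, Module.End.mul_apply, mulMap_xOp, ← mul_assoc, y_mul_x_DAHCa, add_mul,
      add_sub_add_right_eq_sub, mul_assoc, ← mul_sub]
  · simp only [LinearMap.comp_apply, LinearMap.mulLeft_apply]
    rw [yOp_one_tmul, mulMap_one_tmul, mulMap_one_tmul, y_mul_mulReg]

/-- The multiplication map is a homomorphism of modules over the algebra. -/
theorem mulMap_action (u : ℂ) (h : DAHCa n u) (v : Induced n (RegMod n)) :
    mulMap n u (action n u h v) = h * mulMap n u v := by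
  obtain ⟨a, rfl⟩ : ∃ a, DAHCa.mk n u a = h := RingQuot.mkAlgHom_surjective ℂ (Rel n u) h
  induction a using FreeAlgebra.induction generalizing v with
  | grade0 r =>
    rw [AlgHom.commutes, AlgHom.commutes, Module.algebraMap_end_apply, map_smul, Algebra.smul_def]
  | grade1 g =>
    cases g with
    | x i => exact (congrArg (fun T => mulMap n u (T v)) (action_x u i)).trans (mulMap_xOp u i v)
    | y i => exact (congrArg (fun T => mulMap n u (T v)) (action_y u i)).trans (mulMap_yOp u i v)
    | c i => exact (congrArg (fun T => mulMap n u (T v)) (action_c u i)).trans (mulMap_cOp u i v)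
    | s σ => exact (congrArg (fun T => mulMap n u (T v)) (action_s u σ)).trans (mulMap_sOp u σ v)
  | mul a b ha hb => rw [map_mul, map_mul, Module.End.mul_apply, ha, hb, mul_assoc]
  | add a b ha hb => rw [map_add, map_add, LinearMap.add_apply, map_add, ha, hb, add_mul]

theorem action_polyY (u : ℂ) (q : MvPolynomial (Fin n) ℂ) (m : CliffPoly n) :
    action n u (DAHCa.polyY n u q) (tmul 1 (Pi.single 1 m)) =
      tmul 1 (Pi.single 1 (inr n q * m)) := by
  induction q using MvPolynomial.induction_on generalizing m with
  | C a =>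
    rw [← MvPolynomial.algebraMap_eq, AlgHom.commutes, AlgHom.commutes, AlgHom.commutes,
      Module.algebraMap_end_apply, ← Algebra.smul_def, Pi.single_smul, map_smul]
  | add p q hp hq =>
    rw [map_add, map_add, LinearMap.add_apply, hp, hq, map_add, add_mul, Pi.single_add, map_add]
  | mul_X p i hp =>
    rw [map_mul, map_mul, Module.End.mul_apply, DAHCa.polyY_X, action_y, yOp_one_tmul,
      RegMod.y_single_one, hp, map_mul, mul_assoc]

theorem action_cliff (u : ℂ) (a : Cliff n) (m : CliffPoly n) :
    action n u (DAHCa.cliff n u a) (tmul 1 (Pi.single 1 m)) =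
      tmul 1 (Pi.single 1 (inl n a * m)) := by
  induction a using Cliff.induction generalizing m with
  | scalar r =>
    rw [AlgHom.commutes, AlgHom.commutes, AlgHom.commutes,
      Module.algebraMap_end_apply, ← Algebra.smul_def, Pi.single_smul, map_smul]
  | c k => rw [DAHCa.cliff_c, action_c, cOp_one_tmul, RegMod.c_single_one]
  | add a b ha hb =>
    rw [map_add, map_add, LinearMap.add_apply, ha, hb, map_add, add_mul, Pi.single_add, map_add]
  | mul a b ha hb =>
    rw [map_mul, map_mul, Module.End.mul_apply, hb, ha, map_mul, mul_assoc]

/-- The element `1 ⊗ 1 ⊗ 1 ⊗ 1`. -/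
noncomputable def unitVec (n : ℕ) : Induced n (RegMod n) := tmul 1 (Pi.single 1 1)

theorem action_mulCliffPoly (u : ℂ) (m : CliffPoly n) :
    action n u (mulCliffPoly n u m) (unitVec n) = tmul 1 (Pi.single 1 m) := by
  refine LinearMap.congr_fun
    (f := LinearMap.applyₗ (unitVec n) ∘ₗ (action n u).toLinearMap ∘ₗ mulCliffPoly n u)
    (g := tmul 1 ∘ₗ LinearMap.single ℂ (fun _ => CliffPoly n) 1)
    (CliffPoly.hom_ext fun a q => ?_) m
  change action n u (mulCliffPoly n u (inl n a * inr n q)) (tmul 1 (Pi.single 1 1)) =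
    tmul 1 (Pi.single 1 (inl n a * inr n q))
  rw [mulCliffPoly_apply, map_mul, Module.End.mul_apply, action_polyY, action_cliff, mul_one]

theorem action_mulReg (u : ℂ) (w : RegMod n) :
    action n u (mulReg n u w) (unitVec n) = tmul 1 w := by
  rw [mulReg_apply, map_sum, LinearMap.sum_apply]
  conv_rhs => rw [← Finset.univ_sum_single w, map_sum]
  refine Finset.sum_congr rfl fun σ _ => ?_
  rw [map_mul, Module.End.mul_apply, action_mulCliffPoly, action_s, sOp_one_tmul, RegMod.s_single,
    mul_one]

theorem action_mulMap (u : ℂ) (v : Induced n (RegMod n)) :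
    action n u (mulMap n u v) (unitVec n) = v := by
  refine LinearMap.congr_fun
    (f := LinearMap.applyₗ (unitVec n) ∘ₗ (action n u).toLinearMap ∘ₗ mulMap n u)
    (g := LinearMap.id) (xOp_ext (xOp (RegMod n)) (fun j v => ?_) fun w => ?_) v
  · change action n u (mulMap n u (xOp (RegMod n) j v)) (unitVec n) - xOp (RegMod n) j v =
      xOp (RegMod n) j (action n u (mulMap n u v) (unitVec n) - v)
    rw [mulMap_xOp, map_mul, action_x, map_sub, Module.End.mul_apply]
  · change action n u (mulMap n u (tmul 1 w)) (unitVec n) = tmul 1 w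
    rw [mulMap_one_tmul, action_mulReg]

theorem mulMap_unitVec (u : ℂ) : mulMap n u (unitVec n) = 1 := by
  have h : mulCliffPoly n u 1 = 1 := by
    have h1 := mulCliffPoly_apply u (1 : Cliff n) 1
    rwa [map_one, map_one, map_one, map_one, mul_one, mul_one] at h1
  rw [unitVec, mulMap_one_tmul, mulReg_apply, Finset.sum_eq_single 1, Pi.single_eq_same, h,
    (xRel_DAHCa n u).s_one, mul_one]
  · intro σ _ hσ
    rw [Pi.single_eq_of_ne hσ, map_zero, mul_zero]
  · simp

/-- The multiplication map as an isomorphism, with inverse `h ↦ h (1 ⊗ 1 ⊗ 1 ⊗ 1)`. -/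
noncomputable def mulEquiv (n : ℕ) (u : ℂ) : Induced n (RegMod n) ≃ₗ[ℂ] DAHCa n u :=
  LinearEquiv.ofLinearMap (mulMap n u) (LinearMap.applyₗ (unitVec n) ∘ₗ (action n u).toLinearMap)
    (LinearMap.ext fun h => by
      change mulMap n u (action n u h (unitVec n)) = h
      rw [mulMap_action, mulMap_unitVec, mul_one])
    (LinearMap.ext (action_mulMap u))

/-- The identification of `ℂ S_n ⊗ (C_n ⊗ ℂ[y_1, …, y_n])` with functions on `S_n`. -/
noncomputable def regEquiv (n : ℕ) :
    MonoidAlgebra ℂ (Equiv.Perm (Fin n)) ⊗[ℂ] (Cliff n ⊗[ℂ] MvPolynomial (Fin n) ℂ) ≃ₗ[ℂ]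
      RegMod n :=
  TensorProduct.congr
      ((MonoidAlgebra.coeffLinearEquiv ℂ).trans (Finsupp.linearEquivFunOnFinite ℂ ℂ _))
      (CliffPoly.equiv n) ≪≫ₗ
    TensorProduct.comm ℂ _ _ ≪≫ₗ TensorProduct.piScalarRight ℂ ℂ (CliffPoly n) _

theorem regEquiv_tmul (g : MonoidAlgebra ℂ (Equiv.Perm (Fin n))) (a : Cliff n)
    (q : MvPolynomial (Fin n) ℂ) (σ : Equiv.Perm (Fin n)) :
    regEquiv n (g ⊗ₜ (a ⊗ₜ q)) σ = g.coeff σ • (inl n a * inr n q) := by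
  rw [← equiv_tmul]
  simp [regEquiv]

theorem mulReg_regEquiv (u : ℂ) (g : MonoidAlgebra ℂ (Equiv.Perm (Fin n))) (a : Cliff n)
    (q : MvPolynomial (Fin n) ℂ) :
    mulReg n u (regEquiv n (g ⊗ₜ (a ⊗ₜ q))) =
      DAHCa.groupAlg n u g * DAHCa.cliff n u a * DAHCa.polyY n u q := by
  have hg : DAHCa.groupAlg n u g = ∑ σ, g.coeff σ • DAHCa.s u σ := by
    rw [DAHCa.groupAlg, MonoidAlgebra.lift_apply, Finsupp.sum_fintype _ _ (by simp)]
    rfl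
  rw [mulReg_apply, hg, mul_assoc, Finset.sum_mul]
  refine Finset.sum_congr rfl fun σ _ => ?_
  rw [regEquiv_tmul, map_smul, mulCliffPoly_apply, mul_smul_comm, smul_mul_assoc]

end PBW

end DoubleAffineHeckeClifford

/-- The PBW theorem for the rational double affine Hecke-Clifford algebra: multiplication is an
isomorphism of vector spaces `ℂ[x] ⊗ ℂ S_n ⊗ C_n ⊗ ℂ[y] ≅ DAHCa n u`. -/
theorem mainTheorem1 (n : ℕ) (u : ℂ) :
    ∃ e : (MvPolynomial (Fin n) ℂ ⊗[ℂ] MonoidAlgebra ℂ (Equiv.Perm (Fin n)) ⊗[ℂ] Cliff n ⊗[ℂ]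
        MvPolynomial (Fin n) ℂ) ≃ₗ[ℂ] DAHCa n u,
      ∀ (p : MvPolynomial (Fin n) ℂ) (g : MonoidAlgebra ℂ (Equiv.Perm (Fin n))) (a : Cliff n)
        (q : MvPolynomial (Fin n) ℂ),
        e (p ⊗ₜ[ℂ] g ⊗ₜ[ℂ] a ⊗ₜ[ℂ] q) =
          DAHCa.polyX n u p * DAHCa.groupAlg n u g * DAHCa.cliff n u a * DAHCa.polyY n u q := by
  refine ⟨TensorProduct.assoc ℂ _ _ _ ≪≫ₗ TensorProduct.assoc ℂ _ _ _ ≪≫ₗ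
    LinearEquiv.lTensor _ (regEquiv n) ≪≫ₗ Induced.equiv n (RegMod n) ≪≫ₗ mulEquiv n u, ?_⟩
  intro p g a q
  change mulMap n u (Induced.tmul p (regEquiv n (g ⊗ₜ (a ⊗ₜ q)))) = _
  rw [mulMap_tmul, mulReg_regEquiv]
  simp only [mul_assoc]
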